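/- **Theorem 1 (Bessmertnyĭ Realization Theorem).** Let $n,k\ge 0$ be integers and let $f(z)=f(z_1,\dots,z_n)$ be a rational $\mathbb{C}^{k\times k}$-valued matrix function of $n$ complex variables, i.e. a $k\times k$ matrix with entries in the field $\mathbb{C}(z_1,\dots,z_n)$. A *realization* of $f$ consists of an integer $m\ge 0$ and matrices $A_0,A_1,\dots,A_n\in\mathbb{C}^{(k+m)\times(k+m)}$ such that the linear matrix pencil $$A(z)=A_0+z_1A_1+\cdots+z_nA_n=\begin{bmatrix}A_{11}(z)&A_{12}(z)\\A_{21}(z)&A_{22}(z)\end{bmatrix},$$ partitioned with $A_{11}(z)$ of size $k\times k$ and $A_{22}(z)$ of size $m\times m$, satisfies $\det A_{22}(z)\not\equiv 0$ and $$f(z)=A(z)/A_{22}(z):=A_{11}(z)-A_{12}(z)A_{22}(z)^{-1}A_{21}(z)$$ as rational functions (for $m=0$ this means $f(z)=A(z)$, and the determinant condition is void). Every such $f$ has a realization. Moreover (all identities being identities of rational functions): - (a) $f(\lambda z)=\lambda f(z)$ for all $\lambda\in\mathbb{C}\setminus\{0\}$ if and only if $f$ has a realization with $A_0=0$; - (b)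 $f(z)=\overline{f(\overline{z})}$ if and only if $f$ has a realization with $A_j=\overline{A_j}$ for all $j=0,\dots,n$; - (c) $f(z)=f(z)^T$ if and only if $f$ has a realization with $A_j=A_j^T$ for all $j=0,\dots,n$; - (d) $f(z)=f(\overline{z})^*$ if and only if $f$ has a realization with $A_j=A_j^*$ for all $j=0,\dots,n$; - (e) for every subset of the four functional relations in (a)–(d), $f$ satisfies all relations in the subset if and only if $f$ has a single realization whose matrices $A_0,\dots,A_n$ have simultaneously all the associated properties. -/

import Mathlib

/-- The field `ℂ(z₁, …, zₙ)` of rational functions in `n` complex variables. -/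
abbrev RatFun (n : ℕ) : Type := FractionRing (MvPolynomial (Fin n) ℂ)

/-- Polynomials seen as rational functions. -/
noncomputable abbrev polyToRat (n : ℕ) : MvPolynomial (Fin n) ℂ →+* RatFun n :=
  algebraMap (MvPolynomial (Fin n) ℂ) (RatFun n)

/-- Complex numbers seen as constant rational functions. -/
noncomputable def ratConst (n : ℕ) : ℂ →+* RatFun n := (polyToRat n).comp MvPolynomial.C

/-- The coordinate function `z_j` as a rational function. -/
noncomputable def ratVar {n : ℕ} (j : Fin n) : RatFun n := polyToRat n (MvPolynomial.X j)

/-- `p(z) ↦ conj (p (conj z))`: conjugate all coefficients of the polynomial `p`. -/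
noncomputable def polyConj (n : ℕ) : MvPolynomial (Fin n) ℂ →+* MvPolynomial (Fin n) ℂ :=
  MvPolynomial.map (starRingEnd ℂ)

/-- `polyConj` is the operation `p(z) ↦ conj (p (conj z))` on values. -/
theorem eval_polyConj {n : ℕ} (p : MvPolynomial (Fin n) ℂ) (z : Fin n → ℂ) :
    MvPolynomial.eval z (polyConj n p) =
      starRingEnd ℂ (MvPolynomial.eval (fun i => starRingEnd ℂ (z i)) p) := by
  rw [polyConj, MvPolynomial.eval_map]
  induction p using MvPolynomial.induction_on with
  | C a => simp
  | add p q hp hq => simp [hp, hq]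
  | mul_X p i hp => simp [hp]

theorem polyConj_injective (n : ℕ) : Function.Injective (polyConj n) :=
  MvPolynomial.map_injective _ (starRingEnd ℂ).injective

/-- `f(z) ↦ conj (f (conj z))` on rational functions: `p / q ↦ polyConj p / polyConj q`. -/
noncomputable def ratConj (n : ℕ) : RatFun n →+* RatFun n :=
  IsFractionRing.map (polyConj_injective n)

/-- `p(z) ↦ p(c z)` on polynomials. -/
noncomputable def polyScale (n : ℕ) (c : ℂˣ) :
    MvPolynomial (Fin n) ℂ →+* MvPolynomial (Fin n) ℂ :=
  (MvPolynomial.aeval (R := ℂ) fun i => MvPolynomial.C (c : ℂ) * MvPolynomial.X i).toRingHom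

/-- `polyScale` is the operation `p(z) ↦ p(c z)` on values. -/
theorem eval_polyScale {n : ℕ} (c : ℂˣ) (p : MvPolynomial (Fin n) ℂ) (z : Fin n → ℂ) :
    MvPolynomial.eval z (polyScale n c p) = MvPolynomial.eval ((c : ℂ) • z) p := by
  induction p using MvPolynomial.induction_on with
  | C a => simp [polyScale]
  | add p q hp hq => simp [hp, hq]
  | mul_X p i hp =>
    rw [map_mul, map_mul, hp, map_mul]
    simp [polyScale]

theorem polyScale_injective (n : ℕ) (c : ℂˣ) : Function.Injective (polyScale n c) := by
  intro p q h
  apply MvPolynomial.funext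
  intro z
  have h1 := congrArg (MvPolynomial.eval (((c⁻¹ : ℂˣ) : ℂ) • z)) h
  simpa [eval_polyScale, smul_smul] using h1

/-- `f(z) ↦ f(c z)` on rational functions, `c ≠ 0`: `p(z) / q(z) ↦ p(c z) / q(c z)`. -/
noncomputable def ratScale (n : ℕ) (c : ℂˣ) : RatFun n →+* RatFun n :=
  IsFractionRing.map (polyScale_injective n c)

/-- A rational `ℂ^{k×k}`-valued matrix function of `n` complex variables. -/
abbrev RatMatrix (n k : ℕ) : Type := Matrix (Fin k) (Fin k) (RatFun n)

/-- The Schur complement `M / M₂₂ = M₁₁ - M₁₂ M₂₂⁻¹ M₂₁` of a `2 × 2` block matrix. -/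
noncomputable def schurComplement {F : Type*} [Field F] {k m : ℕ}
    (M : Matrix (Fin k ⊕ Fin m) (Fin k ⊕ Fin m) F) : Matrix (Fin k) (Fin k) F :=
  M.toBlocks₁₁ - M.toBlocks₁₂ * M.toBlocks₂₂⁻¹ * M.toBlocks₂₁

/-- The coefficients `A₀, A₁, …, Aₙ` of a linear matrix pencil of square complex matrices in
`2 × 2` block form, with `(1,1)`-block of size `k × k` and `(2,2)`-block of size `m × m`
(`m = 0` is the degenerate case in which the pencil is its own Schur complement). -/
abbrev PencilCoeffs (n k m : ℕ) : Type :=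
  Fin (n + 1) → Matrix (Fin k ⊕ Fin m) (Fin k ⊕ Fin m) ℂ

/-- The linear matrix pencil `A(z) = A₀ + z₁ A₁ + ⋯ + zₙ Aₙ`. -/
noncomputable def pencil {n k m : ℕ} (A : PencilCoeffs n k m) :
    Matrix (Fin k ⊕ Fin m) (Fin k ⊕ Fin m) (RatFun n) :=
  (A 0).map (ratConst n) + ∑ j : Fin n, ratVar j • (A j.succ).map (ratConst n)

/-- `A` realizes `f`: `det A₂₂(z) ≢ 0` and `f(z) = A(z) / A₂₂(z)`. -/
def Realizes {n k m : ℕ} (A : PencilCoeffs n k m) (f : RatMatrix n k) : Prop :=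
  (pencil A).toBlocks₂₂.det ≠ 0 ∧ f = schurComplement (pencil A)

/-- The four kinds of symmetry. -/
inductive SymmetryKind : Type
  | homogeneous
  | real
  | symmetric
  | hermitian

/-- The functional relation on `f` belonging to each kind of symmetry. -/
def FunHas {n k : ℕ} (f : RatMatrix n k) : SymmetryKind → Prop
  | .homogeneous => ∀ c : ℂˣ, f.map (ratScale n c) = ratConst n (c : ℂ) • f
  | .real => f = f.map (ratConj n)
  | .symmetric => f = f.transpose
  | .hermitian => f = (f.map (ratConj n)).transpose

/-- The property of the coefficients `A₀, …, Aₙ` belonging to each kind of symmetry. -/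
def PencilHas {n k m : ℕ} (A : PencilCoeffs n k m) : SymmetryKind → Prop
  | .homogeneous => A 0 = 0
  | .real => ∀ j, A j = (A j).map (starRingEnd ℂ)
  | .symmetric => ∀ j, A j = (A j).transpose
  | .hermitian => ∀ j, A j = (A j).conjTranspose

/-! Functions of the form `a - b D⁻¹ c`, with block entries in a fixed space `V` of linear forms,
are closed under two operations. Sums come from a block diagonal `D`. If `f` is invertible, then `B
f⁻¹ C` arises by making the whole block matrix of `f` the new inverted block (`IsSchur.border`).
These two operations reach every quotient `p / q` with `p ∈ V ^ (d + 1)` and `q ∈ V ^ d`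
(`schurOver_single_div`): `p` is a sum of products `x r z` with `x, z ∈ V` and `r ∈ V ^ d`, and `x r
z / q = x (q / r)⁻¹ z`, where `q / r` is a quotient of the same kind one degree lower. If `V`
consists of all affine forms, every rational function is such a quotient. If `V` is spanned by the
coordinates alone, exactly the functions homogeneous of degree one are, and the resulting pencil has
`A 0 = 0`.

The remaining symmetries are imposed on a given realization. For a real `f`, the representation of
`D` by `[[Re D, -Im D], [Im D, Re D]]` gives a real realization (`IsSchur.realPart`). For `f` equal
to its transpose or adjoint, a half of the realization and its adjoint are joined with an
antidiagonal second block, which makes the whole self-adjoint (`IsSchur.antidiagonal`). Each step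
keeps the properties gained before it, so the steps combine. In the other direction, a symmetry of
the coefficients passes to the Schur complement. -/

open Matrix

/-! ### Operations on Schur complements -/

/-- `f` is the Schur complement `a - b D⁻¹ c` of a block matrix with invertible `D`. -/
def IsSchur {F κ κ' ι : Type*} [Field F] [Fintype ι] [DecidableEq ι]
    (a : Matrix κ κ' F) (b : Matrix κ ι F) (c : Matrix ι κ' F) (D : Matrix ι ι F)
    (f : Matrix κ κ' F) : Prop :=
  D.det ≠ 0 ∧ f = a - b * D⁻¹ * c

section IsSchur

variable {F κ κ' ι : Type*} [Field F] [Fintype ι] [DecidableEq ι]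

/-- A solution of `D * X = c` stands in for `D⁻¹ * c`, so the inverses of composite blocks never
have to be computed. -/
theorem isSchur_of_mul_eq {a : Matrix κ κ' F} {b : Matrix κ ι F} {c : Matrix ι κ' F}
    {D : Matrix ι ι F} {f : Matrix κ κ' F} (X : Matrix ι κ' F) (hD : D.det ≠ 0)
    (hX : D * X = c) (hf : f = a - b * X) : IsSchur a b c D f := by
  refine ⟨hD, ?_⟩
  rw [hf, ← hX, Matrix.mul_assoc, nonsing_inv_mul_cancel_left _ _ (isUnit_iff_ne_zero.2 hD)]

theorem det_ne_zero_of_mul_eq_one {D E : Matrix ι ι F} (h : D * E = 1) : D.det ≠ 0 :=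
  (isUnit_det_of_right_inverse h).ne_zero

theorem IsSchur.submatrix {ι' : Type*} [Fintype ι'] [DecidableEq ι'] (e : ι' ≃ ι)
    {a : Matrix κ κ' F} {b : Matrix κ ι F} {c : Matrix ι κ' F} {D : Matrix ι ι F}
    {f : Matrix κ κ' F} (h : IsSchur a b c D f) :
    IsSchur a (b.submatrix id e) (c.submatrix e id) (D.submatrix e e) f := by
  refine ⟨by rw [det_submatrix_equiv_self]; exact h.1, ?_⟩
  rw [inv_submatrix_equiv, submatrix_mul_equiv, submatrix_mul_equiv, h.2]
  rfl

theorem IsSchur.add {ι' : Type*} [Fintype ι'] [DecidableEq ι']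
    {a a' : Matrix κ κ' F} {b : Matrix κ ι F} {c : Matrix ι κ' F} {D : Matrix ι ι F}
    {b' : Matrix κ ι' F} {c' : Matrix ι' κ' F} {D' : Matrix ι' ι' F}
    {f f' : Matrix κ κ' F} (h : IsSchur a b c D f) (h' : IsSchur a' b' c' D' f') :
    IsSchur (a + a') (fromCols b b') (fromRows c c') (fromBlocks D 0 0 D') (f + f') := by
  have hD := isUnit_iff_ne_zero.2 h.1
  have hD' := isUnit_iff_ne_zero.2 h'.1
  refine isSchur_of_mul_eq (fromRows (D⁻¹ * c) (D'⁻¹ * c')) ?_ ?_ ?_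
  · rw [det_fromBlocks_zero₂₁]
    exact mul_ne_zero h.1 h'.1
  · rw [fromBlocks_mul_fromRows]
    simp [mul_nonsing_inv_cancel_left _ _ hD, mul_nonsing_inv_cancel_left _ _ hD']
  · rw [fromCols_mul_fromRows, h.2, h'.2]
    simp only [Matrix.mul_assoc]
    abel

/-- Bordering the block matrix of an invertible `f` produces `B * f⁻¹ * C`. -/
theorem IsSchur.border {μ μ' : Type*} [Fintype κ] [DecidableEq κ]
    {a : Matrix κ κ F} {b : Matrix κ ι F} {c : Matrix ι κ F} {D : Matrix ι ι F}
    {f : Matrix κ κ F} (h : IsSchur a b c D f) (hf : f.det ≠ 0)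
    (B : Matrix μ κ F) (C : Matrix κ μ' F) :
    IsSchur 0 (fromCols (-B) 0) (fromRows C 0) (fromBlocks a b c D) (B * f⁻¹ * C) := by
  have hD := isUnit_iff_ne_zero.2 h.1
  have hf' := isUnit_iff_ne_zero.2 hf
  let _ : Invertible D := D.invertibleOfIsUnitDet hD
  -- Block elimination: the second row forces `X₂ = -D⁻¹ c X₁`, and the first then reads `f X₁ = C`.
  -- The determinant is `det D * det f`.
  refine isSchur_of_mul_eq (fromRows (f⁻¹ * C) (-(D⁻¹ * c * f⁻¹ * C))) ?_ ?_ ?_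
  · rw [det_fromBlocks₂₂, invOf_eq_nonsing_inv, ← h.2]
    exact mul_ne_zero h.1 hf
  · rw [fromBlocks_mul_fromRows]
    congr 1
    · have : a * (f⁻¹ * C) + b * -(D⁻¹ * c * f⁻¹ * C) = (a - b * D⁻¹ * c) * (f⁻¹ * C) := by
        simp only [Matrix.sub_mul, Matrix.mul_neg, Matrix.mul_assoc]
        abel
      rw [this, ← h.2, mul_nonsing_inv_cancel_left _ _ hf']
    · simp only [Matrix.mul_neg, Matrix.mul_assoc]
      rw [mul_nonsing_inv_cancel_left _ _ hD]
      abel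
  · rw [fromCols_mul_fromRows]
    simp [Matrix.mul_assoc]

end IsSchur

/-! ### Schur complements with entries in a linear subspace -/

/-- `f` is the Schur complement of a block matrix with entries in the subspace `V`. -/
def SchurOver {K F : Type*} [Field K] [Field F] [Algebra K F] (V : Submodule K F) {k : ℕ}
    (f : Matrix (Fin k) (Fin k) F) : Prop :=
  ∃ (m : ℕ) (a : Matrix (Fin k) (Fin k) F) (b : Matrix (Fin k) (Fin m) F)
    (c : Matrix (Fin m) (Fin k) F) (D : Matrix (Fin m) (Fin m) F),
    ((∀ i j, a i j ∈ V) ∧ (∀ i j, b i j ∈ V) ∧ (∀ i j, c i j ∈ V) ∧ ∀ i j, D i j ∈ V) ∧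
      IsSchur a b c D f

section SchurOver

variable {K F : Type*} [Field K] [Field F] [Algebra K F] {V : Submodule K F} {k : ℕ}

theorem IsSchur.schurOver {ι : Type*} [Fintype ι] [DecidableEq ι]
    {a : Matrix (Fin k) (Fin k) F} {b : Matrix (Fin k) ι F} {c : Matrix ι (Fin k) F}
    {D : Matrix ι ι F} {f : Matrix (Fin k) (Fin k) F} (h : IsSchur a b c D f)
    (ha : ∀ i j, a i j ∈ V) (hb : ∀ i j, b i j ∈ V) (hc : ∀ i j, c i j ∈ V)
    (hD : ∀ i j, D i j ∈ V) : SchurOver V f :=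
  ⟨_, _, _, _, _, ⟨ha, fun _ _ => hb _ _, fun _ _ => hc _ _, fun _ _ => hD _ _⟩,
    h.submatrix (Fintype.equivFin ι).symm⟩

theorem SchurOver.of_mem {f : Matrix (Fin k) (Fin k) F} (hf : ∀ i j, f i j ∈ V) :
    SchurOver V f :=
  ⟨0, f, 0, 0, 0, ⟨hf, by simp, by simp, by simp⟩, by simp, by simp⟩

theorem SchurOver.add {f g : Matrix (Fin k) (Fin k) F} (hf : SchurOver V f)
    (hg : SchurOver V g) : SchurOver V (f + g) := by
  obtain ⟨m, a, b, c, D, ⟨ha, hb, hc, hD⟩, h⟩ := hf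
  obtain ⟨m', a', b', c', D', ⟨ha', hb', hc', hD'⟩, h'⟩ := hg
  refine (h.add h').schurOver (fun i j => V.add_mem (ha i j) (ha' i j)) ?_ ?_ ?_
  · rintro i (_ | _) <;> simp [hb, hb']
  · rintro (_ | _) j <;> simp [hc, hc']
  · rintro (_ | _) (_ | _) <;> simp [hD, hD']

theorem SchurOver.sum {α : Type*} (s : Finset α) {f : α → Matrix (Fin k) (Fin k) F}
    (hf : ∀ i ∈ s, SchurOver V (f i)) : SchurOver V (∑ i ∈ s, f i) :=
  Finset.sum_induction _ _ (fun _ _ => SchurOver.add) (.of_mem fun _ _ => V.zero_mem) hf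

theorem SchurOver.border {l : ℕ} {f : Matrix (Fin k) (Fin k) F} (hf : SchurOver V f)
    (hdet : f.det ≠ 0) {B : Matrix (Fin l) (Fin k) F} {C : Matrix (Fin k) (Fin l) F}
    (hB : ∀ i j, B i j ∈ V) (hC : ∀ i j, C i j ∈ V) : SchurOver V (B * f⁻¹ * C) := by
  obtain ⟨m, a, b, c, D, ⟨ha, hb, hc, hD⟩, h⟩ := hf
  refine (h.border hdet B C).schurOver (fun _ _ => V.zero_mem) ?_ ?_ ?_
  · rintro i (_ | _) <;> simp [hB]
  · rintro (_ | _) j <;> simp [hC]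
  · rintro (_ | _) (_ | _) <;> simp [ha, hb, hc, hD]

theorem single_mem {i : Fin k} {l : ℕ} {j' : Fin l} {x : F} (hx : x ∈ V) (i' : Fin k)
    (t : Fin l) : single i j' x i' t ∈ V := by
  rw [single_apply]
  split_ifs
  exacts [hx, V.zero_mem]

/-- Induction on `d` through `x r z / q = x (q / r)⁻¹ z`. The size `k` is quantified inside the
induction because `q / r` is used as a `1 × 1` matrix. -/
theorem schurOver_single_div (d : ℕ) : ∀ {k : ℕ} (i j : Fin k) {p q : F},
    p ∈ V ^ (d + 1) → q ∈ V ^ d → q ≠ 0 → SchurOver V (single i j (p / q)) := by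
  induction d with
  | zero =>
    intro k i j p q hp hq _
    -- Since `V ^ 0` consists of the scalars, `p / q` is a scalar multiple of `p ∈ V`.
    rw [pow_zero, Submodule.mem_one] at hq
    obtain ⟨y, rfl⟩ := hq
    rw [zero_add, pow_one] at hp
    refine .of_mem (single_mem ?_)
    have : p / algebraMap K F y = y⁻¹ • p := by
      rw [Algebra.smul_def, map_inv₀, div_eq_inv_mul]
    rw [this]
    exact V.smul_mem _ hp
  | succ d ih =>
    intro k i j p q hp hq hq0
    have key : ∀ x ∈ V, ∀ r ∈ V ^ d, ∀ z ∈ V,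
        SchurOver V (single i j (x * r * z / q)) := by
      intro x hx r hr z hz
      -- The bordering step inverts `q / r`, so `r = 0` is treated apart.
      rcases eq_or_ne r 0 with rfl | hr0
      · simpa using SchurOver.of_mem (V := V) (f := (0 : Matrix (Fin k) (Fin k) F))
          fun _ _ => V.zero_mem
      have h1 := ih (0 : Fin 1) 0 hq hr hr0
      have hdet : (single (0 : Fin 1) (0 : Fin 1) (q / r)).det ≠ 0 := by
        simpa using ⟨hq0, hr0⟩
      have h2 := h1.border hdet (B := single i 0 x) (C := single 0 j z)
        (single_mem hx) (single_mem hz)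
      convert h2 using 1
      have : (single (0 : Fin 1) (0 : Fin 1) (q / r))⁻¹ = single 0 0 (r / q) := by
        apply inv_eq_right_inv
        rw [single_mul_single_same]
        ext s t
        rw [Subsingleton.elim s 0, Subsingleton.elim t 0]
        simp
        field_simp
      rw [this, single_mul_single_same, single_mul_single_same]
      congr 1
      ring
    have hadd : ∀ a b : F, single i j ((a + b) / q) = single i j (a / q) + single i j (b / q) :=
      fun a b => by rw [← single_add, add_div]
    -- `V ^ (d + 2) = (V * V ^ d) * V`, so `p` is a sum of products covered by `key`.
    rw [pow_succ, pow_succ'] at hp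
    induction hp using Submodule.mul_induction_on' with
    | mem_mul_mem y hy z hz =>
      induction hy using Submodule.mul_induction_on' with
      | mem_mul_mem x hx r hr => exact key x hx r hr z hz
      | add a _ b _ ha hb =>
        rw [add_mul, hadd]
        exact ha.add hb
    | add a _ b _ ha hb =>
      rw [hadd]
      exact ha.add hb

theorem schurOver_of_entries {f : Matrix (Fin k) (Fin k) F}
    (hf : ∀ i j, ∃ d, ∃ p ∈ V ^ (d + 1), ∃ q ∈ V ^ d, q ≠ 0 ∧ f i j = p / q) :
    SchurOver V f := by
  rw [matrix_eq_sum_single f]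
  refine .sum _ fun i _ => .sum _ fun j _ => ?_
  obtain ⟨d, p, hp, q, hq, hq0, h⟩ := hf i j
  rw [h]
  exact schurOver_single_div d i j hp hq hq0

end SchurOver

/-! ### Pencils as matrices of affine forms -/

/-- The affine linear function `a₀ + z₁ a₁ + ⋯ + zₙ aₙ`. -/
noncomputable def linForm (n : ℕ) : (Fin (n + 1) → ℂ) →ₗ[ℂ] RatFun n :=
  Fintype.linearCombination ℂ (Fin.cons 1 ratVar : Fin (n + 1) → RatFun n)

theorem ratConst_eq_algebraMap (n : ℕ) (c : ℂ) : ratConst n c = algebraMap ℂ (RatFun n) c := by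
  rw [IsScalarTower.algebraMap_apply ℂ (MvPolynomial (Fin n) ℂ) (RatFun n)]
  rfl

theorem linForm_apply {n : ℕ} (a : Fin (n + 1) → ℂ) :
    linForm n a = ratConst n (a 0) + ∑ j : Fin n, ratVar j * ratConst n (a j.succ) := by
  simp [linForm, Fintype.linearCombination_apply, Fin.sum_univ_succ, Algebra.smul_def,
    ratConst_eq_algebraMap, mul_comm]

/-- The pencil with coefficient matrices `A₀, …, Aₙ` of arbitrary shape. -/
noncomputable def linPencil {n : ℕ} {α β : Type*} (A : Fin (n + 1) → Matrix α β ℂ) :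
    Matrix α β (RatFun n) :=
  Matrix.of fun i j => linForm n fun l => A l i j

theorem linPencil_apply {n : ℕ} {α β : Type*} (A : Fin (n + 1) → Matrix α β ℂ) (i : α) (j : β) :
    linPencil A i j = linForm n fun l => A l i j := rfl

theorem pencil_eq_linPencil {n k m : ℕ} (A : PencilCoeffs n k m) : pencil A = linPencil A := by
  ext i j
  simp [pencil, linPencil_apply, linForm_apply, Matrix.sum_apply]

theorem linPencil_fromBlocks {n : ℕ} {α β γ δ : Type*} (a : Fin (n + 1) → Matrix α γ ℂ)
    (b : Fin (n + 1) → Matrix α δ ℂ) (c : Fin (n + 1) → Matrix β γ ℂ)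
    (D : Fin (n + 1) → Matrix β δ ℂ) :
    linPencil (fun l => fromBlocks (a l) (b l) (c l) (D l)) =
      fromBlocks (linPencil a) (linPencil b) (linPencil c) (linPencil D) := by
  ext (i | i) (j | j) <;> rfl

theorem linPencil_fromCols {n : ℕ} {α β γ : Type*} (a : Fin (n + 1) → Matrix α β ℂ)
    (b : Fin (n + 1) → Matrix α γ ℂ) :
    linPencil (fun l => fromCols (a l) (b l)) = fromCols (linPencil a) (linPencil b) := by
  ext i (j | j) <;> rfl

theorem linPencil_fromRows {n : ℕ} {α β γ : Type*} (a : Fin (n + 1) → Matrix α γ ℂ)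
    (b : Fin (n + 1) → Matrix β γ ℂ) :
    linPencil (fun l => fromRows (a l) (b l)) = fromRows (linPencil a) (linPencil b) := by
  ext (i | i) j <;> rfl

/-- `A` realizes `f`, with an arbitrary finite index type for the second block. -/
def BlockRealizes {n k : ℕ} {ι : Type*} [Fintype ι] [DecidableEq ι]
    (a : Fin (n + 1) → Matrix (Fin k) (Fin k) ℂ) (b : Fin (n + 1) → Matrix (Fin k) ι ℂ)
    (c : Fin (n + 1) → Matrix ι (Fin k) ℂ) (D : Fin (n + 1) → Matrix ι ι ℂ)
    (f : RatMatrix n k) : Prop :=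
  IsSchur (linPencil a) (linPencil b) (linPencil c) (linPencil D) f

/-- Rows and columns are reindexed by the same `e`, so symmetry of the coefficients can be checked
before reindexing. -/
theorem BlockRealizes.exists_realizes {n k : ℕ} {ι : Type*} [Fintype ι] [DecidableEq ι]
    {a : Fin (n + 1) → Matrix (Fin k) (Fin k) ℂ} {b : Fin (n + 1) → Matrix (Fin k) ι ℂ}
    {c : Fin (n + 1) → Matrix ι (Fin k) ℂ} {D : Fin (n + 1) → Matrix ι ι ℂ}
    {f : RatMatrix n k} (h : BlockRealizes a b c D f) :
    ∃ (m : ℕ) (e : Fin k ⊕ Fin m ≃ Fin k ⊕ ι),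
      Realizes (fun l => (fromBlocks (a l) (b l) (c l) (D l)).submatrix e e) f := by
  refine ⟨_, Equiv.sumCongr (Equiv.refl _) (Fintype.equivFin ι).symm, ?_⟩
  have h' := h.submatrix (Fintype.equivFin ι).symm
  rw [Realizes, pencil_eq_linPencil]
  exact h'

theorem Realizes.blockRealizes {n k m : ℕ} {A : PencilCoeffs n k m} {f : RatMatrix n k}
    (h : Realizes A f) :
    BlockRealizes (fun l => (A l).toBlocks₁₁) (fun l => (A l).toBlocks₁₂)
      (fun l => (A l).toBlocks₂₁) (fun l => (A l).toBlocks₂₂) f := by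
  rw [Realizes, pencil_eq_linPencil] at h
  exact h

/-- The subspace `W` carries linear constraints on the coefficients, in particular `A 0 = 0`, from
the forms to the pencil. -/
theorem SchurOver.exists_realizes {n k : ℕ} {W : Submodule ℂ (Fin (n + 1) → ℂ)}
    {f : RatMatrix n k} (h : SchurOver (W.map (linForm n)) f) :
    ∃ (m : ℕ) (A : PencilCoeffs n k m), Realizes A f ∧ ∀ i j, (fun l => A l i j) ∈ W := by
  obtain ⟨m, a, b, c, D, ⟨ha, hb, hc, hD⟩, h⟩ := h
  choose a' haW ha using ha
  choose b' hbW hb using hb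
  choose c' hcW hc using hc
  choose D' hDW hD using hD
  refine ⟨m, fun l => fromBlocks (.of fun i j => a' i j l) (.of fun i j => b' i j l)
    (.of fun i j => c' i j l) (.of fun i j => D' i j l), ?_, ?_⟩
  · rw [Realizes, pencil_eq_linPencil]
    have ea : linPencil (fun l => Matrix.of fun i j => a' i j l) = a := Matrix.ext ha
    have eb : linPencil (fun l => Matrix.of fun i j => b' i j l) = b := Matrix.ext hb
    have ec : linPencil (fun l => Matrix.of fun i j => c' i j l) = c := Matrix.ext hc
    have eD : linPencil (fun l => Matrix.of fun i j => D' i j l) = D := Matrix.ext hD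
    rw [← ea, ← eb, ← ec, ← eD] at h
    exact h
  · rintro (i | i) (j | j)
    exacts [haW i j, hbW i j, hcW i j, hDW i j]

/-! ### Existence of a realization -/

theorem ratVar_mem_map_linForm {n : ℕ} (j : Fin n) {W : Submodule ℂ (Fin (n + 1) → ℂ)}
    (hW : Pi.single j.succ 1 ∈ W) : ratVar j ∈ W.map (linForm n) :=
  ⟨_, hW, by simp [linForm]⟩

theorem exists_mem_pow_map_linForm {n : ℕ} (p : MvPolynomial (Fin n) ℂ) :
    ∃ d, polyToRat n p ∈ (Submodule.map (linForm n) ⊤) ^ d := by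
  have h1 : (1 : Submodule ℂ (RatFun n)) ≤ Submodule.map (linForm n) ⊤ :=
    Submodule.one_le.2 ⟨Pi.single 0 1, trivial, by simp [linForm]⟩
  induction p using MvPolynomial.induction_on with
  | C a => exact ⟨0, by
      rw [pow_zero, Submodule.mem_one]
      exact ⟨a, (ratConst_eq_algebraMap n a).symm⟩⟩
  | add p q hp hq =>
    obtain ⟨d, hd⟩ := hp
    obtain ⟨e, he⟩ := hq
    refine ⟨max d e, ?_⟩
    rw [map_add]
    exact Submodule.add_mem _ (pow_le_pow_right₀ h1 (le_max_left d e) hd)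
      (pow_le_pow_right₀ h1 (le_max_right d e) he)
  | mul_X p i hp =>
    obtain ⟨d, hd⟩ := hp
    refine ⟨d + 1, ?_⟩
    rw [map_mul, pow_succ]
    exact Submodule.mul_mem_mul hd (ratVar_mem_map_linForm i trivial)

theorem exists_realizes {n k : ℕ} (f : RatMatrix n k) :
    ∃ (m : ℕ) (A : PencilCoeffs n k m), Realizes A f := by
  have h1 : (1 : Submodule ℂ (RatFun n)) ≤ Submodule.map (linForm n) ⊤ :=
    Submodule.one_le.2 ⟨Pi.single 0 1, trivial, by simp [linForm]⟩
  have : SchurOver (Submodule.map (linForm n) ⊤) f := by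
    refine schurOver_of_entries fun i j => ?_
    obtain ⟨p, q, hq, h⟩ := IsFractionRing.div_surjective (A := MvPolynomial (Fin n) ℂ) (f i j)
    obtain ⟨d, hd⟩ := exists_mem_pow_map_linForm p
    obtain ⟨e, he⟩ := exists_mem_pow_map_linForm q
    -- The affine forms contain `1`, so their powers increase and the exponents of `p` and `q` can
    -- be raised to `max d e + 1` and `max d e`.
    refine ⟨max d e, _, pow_le_pow_right₀ h1 ((le_max_left d e).trans (Nat.le_succ _)) hd,
      _, pow_le_pow_right₀ h1 (le_max_right d e) he, ?_, h.symm⟩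
    exact IsFractionRing.to_map_ne_zero_of_mem_nonZeroDivisors hq
  obtain ⟨m, A, h, -⟩ := this.exists_realizes
  exact ⟨m, A, h⟩

/-! ### Functions homogeneous of degree one -/

/-- Coefficient families with vanishing constant coefficient. -/
def noConst (n : ℕ) : Submodule ℂ (Fin (n + 1) → ℂ) :=
  LinearMap.ker (LinearMap.proj (R := ℂ) (φ := fun _ : Fin (n + 1) => ℂ) 0)

/-- Forms of degree `d` make up the `d`-th power of the span of the coordinates. -/
theorem isHomogeneous_mem_pow {n d : ℕ} {p : MvPolynomial (Fin n) ℂ} (hp : p.IsHomogeneous d) :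
    polyToRat n p ∈ ((noConst n).map (linForm n)) ^ d := by
  have hp' : p ∈ MvPolynomial.homogeneousSubmodule (Fin n) ℂ d := hp
  rw [← MvPolynomial.homogeneousSubmodule_one_pow] at hp'
  have h2 := Submodule.mem_map_of_mem
    (f := (IsScalarTower.toAlgHom ℂ (MvPolynomial (Fin n) ℂ) (RatFun n)).toLinearMap) hp'
  rw [Submodule.map_pow] at h2
  refine pow_le_pow_left' (?_ : _ ≤ (noConst n).map (linForm n)) d h2
  rw [MvPolynomial.homogeneousSubmodule_one_eq_span_X, Submodule.map_span, Submodule.span_le]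
  rintro _ ⟨_, ⟨j, rfl⟩, rfl⟩
  exact ratVar_mem_map_linForm j (by simp [noConst])

theorem polyScale_of_isHomogeneous {n d : ℕ} {p : MvPolynomial (Fin n) ℂ}
    (hp : p.IsHomogeneous d) (c : ℂˣ) : polyScale n c p = MvPolynomial.C (c : ℂ) ^ d * p := by
  refine MvPolynomial.funext fun z => ?_
  rw [eval_polyScale, map_mul, map_pow, MvPolynomial.eval_C, MvPolynomial.eval_eq',
    MvPolynomial.eval_eq', Finset.mul_sum]
  refine Finset.sum_congr rfl fun e he => ?_
  have hd : ∑ i, e i = d := by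
    rw [← hp (MvPolynomial.mem_support_iff.1 he)]
    simp [Finsupp.weight_apply, Finsupp.sum_fintype]
  simp only [Pi.smul_apply, smul_eq_mul, mul_pow, Finset.prod_mul_distrib,
    Finset.prod_pow_eq_pow_sum, hd]
  ring

theorem polyScale_eq_sum {n N : ℕ} {p : MvPolynomial (Fin n) ℂ} (hN : p.totalDegree < N)
    (c : ℂˣ) : polyScale n c p =
      ∑ i ∈ Finset.range N, MvPolynomial.C (c : ℂ) ^ i * p.homogeneousComponent i := by
  have h : ∑ i ∈ Finset.range N, p.homogeneousComponent i = p := by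
    conv_rhs => rw [← MvPolynomial.sum_homogeneousComponent p]
    refine (Finset.sum_subset (Finset.range_mono hN) fun i _ hi => ?_).symm
    exact MvPolynomial.homogeneousComponent_eq_zero _ _ (by simpa using hi)
  conv_lhs => rw [← h, map_sum]
  exact Finset.sum_congr rfl fun i _ =>
    polyScale_of_isHomogeneous (MvPolynomial.homogeneousComponent_isHomogeneous i p) c

/-- Both sides of `p(cz) q(z) = c p(z) q(cz)` are polynomials in `c` that agree for infinitely many
`c`; the conclusion compares the coefficients of `c ^ (j + 1)`. -/
theorem homogeneousComponent_mul_eq {n : ℕ} {p q : MvPolynomial (Fin n) ℂ}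
    (h : ∀ c : ℂˣ, polyScale n c p * q = MvPolynomial.C (c : ℂ) * (p * polyScale n c q)) (j : ℕ) :
    p.homogeneousComponent (j + 1) * q = p * q.homogeneousComponent j := by
  -- `N` exceeds both total degrees and `j + 1`, so truncation loses neither a component nor the
  -- coefficient compared.
  set N := p.totalDegree + q.totalDegree + j + 2 with hN
  have key : ∑ i ∈ Finset.range N, Polynomial.monomial i (p.homogeneousComponent i * q) =
      ∑ i ∈ Finset.range N, Polynomial.monomial (i + 1) (p * q.homogeneousComponent i) := by
    apply Polynomial.eq_of_infinite_eval_eq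
    refine Set.Infinite.mono (s := MvPolynomial.C '' {c : ℂ | c ≠ 0}) ?_
      ((Set.Finite.infinite_compl (Set.finite_singleton (0 : ℂ))).image
        (MvPolynomial.C_injective _ _).injOn)
    rintro _ ⟨c, hc, rfl⟩
    have hc' := h (Units.mk0 c hc)
    rw [polyScale_eq_sum (N := N) (by omega), polyScale_eq_sum (N := N) (by omega),
      Finset.sum_mul, Finset.mul_sum, Finset.mul_sum] at hc'
    simp only [Set.mem_ofPred_eq, Polynomial.eval_finsetSum, Polynomial.eval_monomial]
    convert hc' using 2 with i _ i _
    · rw [Units.val_mk0]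
      ring
    · rw [Units.val_mk0]
      ring
  have := congrArg (fun P => Polynomial.coeff P (j + 1)) key
  have hj : j < N := by omega
  simpa [Polynomial.coeff_monomial, hj, show j + 1 < N by omega] using this

theorem ratScale_polyToRat {n : ℕ} (c : ℂˣ) (p : MvPolynomial (Fin n) ℂ) :
    ratScale n c (polyToRat n p) = polyToRat n (polyScale n c p) := by
  rw [ratScale, IsFractionRing.map]
  exact IsLocalization.map_eq _ _

theorem ratConj_polyToRat {n : ℕ} (p : MvPolynomial (Fin n) ℂ) :
    ratConj n (polyToRat n p) = polyToRat n (polyConj n p) := by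
  rw [ratConj, IsFractionRing.map]
  exact IsLocalization.map_eq _ _

theorem polyToRat_injective (n : ℕ) : Function.Injective (polyToRat n) :=
  IsFractionRing.injective _ _

/-- If `g = p / q`, then also `g = p_{j+1} / q_j` for any `j` whose component `q_j` is nonzero.
Without constants in the space of forms, exponents cannot be padded, so the degrees have to differ
by exactly one. -/
theorem exists_homogeneous_div {n : ℕ} {g : RatFun n}
    (h : ∀ c : ℂˣ, ratScale n c g = ratConst n c * g) :
    ∃ (d : ℕ) (p q : MvPolynomial (Fin n) ℂ), p.IsHomogeneous (d + 1) ∧ q.IsHomogeneous d ∧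
      q ≠ 0 ∧ g = polyToRat n p / polyToRat n q := by
  obtain ⟨p, q, hq, rfl⟩ := IsFractionRing.div_surjective (A := MvPolynomial (Fin n) ℂ) g
  have hq0 : q ≠ 0 := nonZeroDivisors.ne_zero hq
  have hne : ∀ {r}, r ≠ 0 → polyToRat n r ≠ 0 := fun hr =>
    (map_ne_zero_iff _ (polyToRat_injective n)).2 hr
  have hs : ∀ c : ℂˣ,
      polyScale n c p * q = MvPolynomial.C (c : ℂ) * (p * polyScale n c q) := by
    intro c
    have hc := h c
    rw [map_div₀, ratScale_polyToRat, ratScale_polyToRat,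
      mul_div_assoc', div_eq_div_iff
        (hne ((map_ne_zero_iff _ (polyScale_injective n c)).2 hq0)) (hne hq0)] at hc
    apply polyToRat_injective
    rw [map_mul, hc, map_mul, map_mul]
    simp only [ratConst, RingHom.comp_apply]
    ring
  obtain ⟨j, hj⟩ : ∃ j, q.homogeneousComponent j ≠ 0 := by
    by_contra! hall
    exact hq0 (by rw [← MvPolynomial.sum_homogeneousComponent q]; simp [hall])
  refine ⟨j, _, _, MvPolynomial.homogeneousComponent_isHomogeneous (j + 1) p,
    MvPolynomial.homogeneousComponent_isHomogeneous j q, hj, ?_⟩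
  rw [div_eq_div_iff (hne hq0) (hne hj), ← map_mul, ← map_mul,
    homogeneousComponent_mul_eq hs]

theorem exists_realizes_of_homogeneous {n k : ℕ} {f : RatMatrix n k}
    (h : FunHas f .homogeneous) :
    ∃ (m : ℕ) (A : PencilCoeffs n k m), Realizes A f ∧ A 0 = 0 := by
  have : SchurOver (Submodule.map (linForm n) (noConst n)) f := by
    refine schurOver_of_entries fun i j => ?_
    obtain ⟨d, p, q, hp, hq, hq0, hf⟩ := exists_homogeneous_div (g := f i j)
      fun c => congrFun (congrFun (h c) i) j
    exact ⟨d, _, isHomogeneous_mem_pow hp, _, isHomogeneous_mem_pow hq,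
      (map_ne_zero_iff _ (polyToRat_injective n)).2 hq0, hf⟩
  obtain ⟨m, A, h, hA⟩ := this.exists_realizes
  exact ⟨m, A, h, Matrix.ext fun i j => hA i j⟩

/-! ### Real parts and adjoints of Schur complements -/

section Involution

variable {F : Type*} [Field F]

theorem map_inv_of_det_ne_zero {ι : Type*} [Fintype ι] [DecidableEq ι] (τ : F →+* F)
    {D : Matrix ι ι F} (hD : D.det ≠ 0) : D⁻¹.map τ = (D.map τ)⁻¹ := by
  refine (inv_eq_right_inv ?_).symm
  rw [← Matrix.map_mul, mul_nonsing_inv _ (isUnit_iff_ne_zero.2 hD)]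
  exact Matrix.map_one τ (map_zero τ) (map_one τ)

/-- The real part of a matrix with respect to a field endomorphism. -/
noncomputable def matRe {α β : Type*} (τ : F →+* F) (M : Matrix α β F) : Matrix α β F :=
  (2⁻¹ : F) • (M + M.map τ)

/-- The imaginary part of a matrix with respect to a field endomorphism. -/
noncomputable def matIm {α β : Type*} (τ : F →+* F) (I : F) (M : Matrix α β F) :
    Matrix α β F :=
  ((2 * I)⁻¹ : F) • (M - M.map τ)

/-- The usual rule for `M = Re M + I Im M`. It rests only on `I * I = -1` and multiplicativity of
`τ`; neither `τ I = -I` nor `τ ∘ τ = id` is needed. -/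
theorem matRe_mul {α β γ : Type*} [Fintype γ] (h2 : (2 : F) ≠ 0) (τ : F →+* F) {I : F} (hI : I * I = -1)
    (M : Matrix α γ F) (N : Matrix γ β F) :
    matRe τ (M * N) = matRe τ M * matRe τ N - matIm τ I M * matIm τ I N := by
  have hI0 : I ≠ 0 := by
    rintro rfl
    simp at hI
  have hI2 : I ^ 2 = -1 := by rw [sq, hI]
  simp only [matRe, matIm, Matrix.map_mul, Matrix.smul_mul, Matrix.mul_smul, 
    Matrix.mul_add, Matrix.add_mul, Matrix.mul_sub, Matrix.sub_mul]
  ext i j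
  simp only [Matrix.add_apply, Matrix.sub_apply, Matrix.smul_apply, smul_eq_mul]
  field_simp
  simp only [hI2]
  ring

theorem matIm_mul {α β γ : Type*} [Fintype γ] (h2 : (2 : F) ≠ 0) (τ : F →+* F) {I : F} (hI : I * I = -1)
    (M : Matrix α γ F) (N : Matrix γ β F) :
    matIm τ I (M * N) = matIm τ I M * matRe τ N + matRe τ M * matIm τ I N := by
  have hI0 : I ≠ 0 := by
    rintro rfl
    simp at hI
  simp only [matRe, matIm, Matrix.map_mul, Matrix.smul_mul, Matrix.mul_smul, 
    Matrix.mul_add, Matrix.add_mul, Matrix.mul_sub, Matrix.sub_mul]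
  ext i j
  simp only [Matrix.add_apply, Matrix.sub_apply, Matrix.smul_apply, smul_eq_mul]
  field_simp
  ring

variable {κ κ' ι : Type*} [Fintype ι] [DecidableEq ι]

theorem IsSchur.map {a : Matrix κ κ' F} {b : Matrix κ ι F} {c : Matrix ι κ' F}
    {D : Matrix ι ι F} {f : Matrix κ κ' F} (h : IsSchur a b c D f) (τ : F →+* F) :
    IsSchur (a.map τ) (b.map τ) (c.map τ) (D.map τ) (f.map τ) := by
  refine ⟨?_, ?_⟩
  · rw [← RingHom.mapMatrix_apply, ← RingHom.map_det]
    exact (map_ne_zero τ).2 h.1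
  · rw [h.2, ← map_inv_of_det_ne_zero τ h.1, ← Matrix.map_mul, ← Matrix.map_mul,
      Matrix.map_sub τ (map_sub τ)]

theorem IsSchur.transpose {a : Matrix κ κ' F} {b : Matrix κ ι F} {c : Matrix ι κ' F}
    {D : Matrix ι ι F} {f : Matrix κ κ' F} (h : IsSchur a b c D f) :
    IsSchur aᵀ cᵀ bᵀ Dᵀ fᵀ := by
  refine ⟨by rw [det_transpose]; exact h.1, ?_⟩
  rw [h.2, ← transpose_nonsing_inv, transpose_sub, transpose_mul, transpose_mul,
    Matrix.mul_assoc]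

theorem IsSchur.smul {a : Matrix κ κ' F} {b : Matrix κ ι F} {c : Matrix ι κ' F}
    {D : Matrix ι ι F} {f : Matrix κ κ' F} (h : IsSchur a b c D f) {r : F} (hr : r ≠ 0) :
    IsSchur (r • a) (r • b) (r • c) (r • D) (r • f) := by
  have hD := isUnit_iff_ne_zero.2 h.1
  refine isSchur_of_mul_eq (D⁻¹ * c) ?_ ?_ ?_
  · rw [det_smul]
    exact mul_ne_zero (pow_ne_zero _ hr) h.1
  · rw [smul_mul, mul_nonsing_inv_cancel_left _ _ hD]
  · rw [h.2, smul_mul, smul_sub, Matrix.mul_assoc]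

/-- Two block matrices with the same size combine into one with antidiagonal second block
whose Schur complement is the sum. -/
theorem IsSchur.antidiagonal {a a' : Matrix κ κ' F} {b b' : Matrix κ ι F} {c c' : Matrix ι κ' F}
    {D D' : Matrix ι ι F} {f f' : Matrix κ κ' F} (h : IsSchur a b c D f)
    (h' : IsSchur a' b' c' D' f') :
    IsSchur (a + a') (fromCols b b') (fromRows c' c) (fromBlocks 0 D' D 0) (f + f') := by
  have hD := isUnit_iff_ne_zero.2 h.1
  have hD' := isUnit_iff_ne_zero.2 h'.1
  refine isSchur_of_mul_eq (fromRows (D⁻¹ * c) (D'⁻¹ * c')) ?_ ?_ ?_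
  · refine det_ne_zero_of_mul_eq_one (E := fromBlocks 0 D⁻¹ D'⁻¹ 0) ?_
    rw [fromBlocks_multiply]
    simp [mul_nonsing_inv _ hD, mul_nonsing_inv _ hD']
  · rw [fromBlocks_mul_fromRows]
    simp [mul_nonsing_inv_cancel_left _ _ hD, mul_nonsing_inv_cancel_left _ _ hD']
  · rw [fromCols_mul_fromRows, h.2, h'.2]
    simp only [Matrix.mul_assoc]
    abel

/-- `M ↦ [[Re M, -Im M], [Im M, Re M]]` is multiplicative and unital, so it takes `D⁻¹` to an
inverse. Real and imaginary parts of `D X = c` give the enlarged system, and the real part of `a - b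
X` gives the value. -/
theorem IsSchur.realPart {a : Matrix κ κ' F} {b : Matrix κ ι F} {c : Matrix ι κ' F}
    {D : Matrix ι ι F} {f : Matrix κ κ' F} (h : IsSchur a b c D f) (h2 : (2 : F) ≠ 0)
    (τ : F →+* F) {I : F} (hI : I * I = -1) :
    IsSchur (matRe τ a) (fromCols (matRe τ b) (-matIm τ I b))
      (fromRows (matRe τ c) (matIm τ I c))
      (fromBlocks (matRe τ D) (-matIm τ I D) (matIm τ I D) (matRe τ D)) (matRe τ f) := by
  have hD := isUnit_iff_ne_zero.2 h.1
  have hmap : (1 : Matrix ι ι F).map τ = 1 := Matrix.map_one τ (map_zero τ) (map_one τ)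
  have hre : matRe τ (1 : Matrix ι ι F) = 1 := by
    rw [matRe, hmap, ← two_smul F, smul_smul, inv_mul_cancel₀ h2, one_smul]
  have him : matIm τ I (1 : Matrix ι ι F) = 0 := by
    rw [matIm, hmap, sub_self, smul_zero]
  have hreD := matRe_mul h2 τ hI D D⁻¹
  have himD := matIm_mul h2 τ hI D D⁻¹
  rw [mul_nonsing_inv _ hD, hre] at hreD
  rw [mul_nonsing_inv _ hD, him] at himD
  refine isSchur_of_mul_eq (fromRows (matRe τ (D⁻¹ * c)) (matIm τ I (D⁻¹ * c))) ?_ ?_ ?_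
  · refine det_ne_zero_of_mul_eq_one
      (E := fromBlocks (matRe τ D⁻¹) (-matIm τ I D⁻¹) (matIm τ I D⁻¹) (matRe τ D⁻¹)) ?_
    rw [fromBlocks_multiply, ← fromBlocks_one]
    congr 1
    · rw [Matrix.neg_mul, ← sub_eq_add_neg, ← hreD]
    · rw [Matrix.neg_mul, Matrix.mul_neg, ← neg_add, add_comm, ← himD, neg_zero]
    · exact himD.symm
    · rw [Matrix.mul_neg, neg_add_eq_sub, ← hreD]
  · rw [fromBlocks_mul_fromRows, Matrix.neg_mul, ← sub_eq_add_neg, ← matRe_mul h2 τ hI,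
      ← matIm_mul h2 τ hI, mul_nonsing_inv_cancel_left _ _ hD]
  · rw [fromCols_mul_fromRows, Matrix.neg_mul, ← sub_eq_add_neg, ← matRe_mul h2 τ hI, h.2,
      Matrix.mul_assoc]
    simp only [matRe, Matrix.map_sub τ (map_sub τ)]
    rw [← smul_sub]
    congr 1
    abel

end Involution

/-! ### Passing symmetries between coefficients and pencils -/

/-- `τ` acts on rational functions by `σ` on constants and fixes the coordinates. -/
def ExtendsConst {n : ℕ} (σ : ℂ →+* ℂ) (τ : RatFun n →+* RatFun n) : Prop :=
  (∀ c, τ (ratConst n c) = ratConst n (σ c)) ∧ ∀ j, τ (ratVar j) = ratVar j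

theorem extendsConst_id (n : ℕ) : ExtendsConst (RingHom.id ℂ) (RingHom.id (RatFun n)) :=
  ⟨fun _ => rfl, fun _ => rfl⟩

theorem extendsConst_ratConj (n : ℕ) : ExtendsConst (starRingEnd ℂ) (ratConj n) :=
  ⟨fun c => by simp [ratConst, ratConj_polyToRat, polyConj],
    fun j => by simp [ratVar, ratConj_polyToRat, polyConj]⟩

section linPencil

variable {n : ℕ} {α β : Type*}

theorem linPencil_map {σ : ℂ →+* ℂ} {τ : RatFun n →+* RatFun n} (h : ExtendsConst σ τ)
    (A : Fin (n + 1) → Matrix α β ℂ) :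
    linPencil (fun l => (A l).map σ) = (linPencil A).map τ := by
  ext i j
  simp [linPencil_apply, linForm_apply, h.1, h.2]

theorem linPencil_transpose (A : Fin (n + 1) → Matrix α β ℂ) :
    linPencil (fun l => (A l)ᵀ) = (linPencil A)ᵀ := rfl

theorem linPencil_add (A B : Fin (n + 1) → Matrix α β ℂ) :
    linPencil (fun l => A l + B l) = linPencil A + linPencil B := by
  ext i j
  exact map_add (linForm n) (fun l => A l i j) fun l => B l i j

theorem linPencil_sub (A B : Fin (n + 1) → Matrix α β ℂ) :
    linPencil (fun l => A l - B l) = linPencil A - linPencil B := by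
  ext i j
  exact map_sub (linForm n) (fun l => A l i j) fun l => B l i j

theorem linPencil_neg (A : Fin (n + 1) → Matrix α β ℂ) :
    linPencil (fun l => -A l) = -linPencil A := by
  ext i j
  exact map_neg (linForm n) (fun l => A l i j)

theorem linPencil_zero : linPencil (fun _ => 0 : Fin (n + 1) → Matrix α β ℂ) = 0 := by
  ext i j
  exact map_zero (linForm n)

theorem linPencil_smul (c : ℂ) (A : Fin (n + 1) → Matrix α β ℂ) :
    linPencil (fun l => c • A l) = ratConst n c • linPencil A := by
  ext i j
  rw [Matrix.smul_apply, ratConst_eq_algebraMap, algebraMap_smul]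
  exact map_smul (linForm n) c fun l => A l i j

theorem linPencil_matRe {σ : ℂ →+* ℂ} {τ : RatFun n →+* RatFun n} (h : ExtendsConst σ τ)
    (A : Fin (n + 1) → Matrix α β ℂ) :
    linPencil (fun l => matRe σ (A l)) = matRe τ (linPencil A) := by
  simp only [matRe, linPencil_smul, linPencil_add, linPencil_map h, map_inv₀, map_ofNat]

theorem linPencil_matIm {σ : ℂ →+* ℂ} {τ : RatFun n →+* RatFun n} (h : ExtendsConst σ τ)
    (I : ℂ) (A : Fin (n + 1) → Matrix α β ℂ) :
    linPencil (fun l => matIm σ I (A l)) = matIm τ (ratConst n I) (linPencil A) := by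
  simp only [matIm, linPencil_smul, linPencil_sub, linPencil_map h, map_inv₀, map_mul, map_ofNat]

theorem linPencil_map_ratScale {A : Fin (n + 1) → Matrix α β ℂ} (hA : A 0 = 0) (c : ℂˣ) :
    (linPencil A).map (ratScale n c) = ratConst n c • linPencil A := by
  have hc : ∀ r, ratScale n c (ratConst n r) = ratConst n r := fun r => by
    simp [ratConst, ratScale_polyToRat, polyScale]
  have hv : ∀ j, ratScale n c (ratVar j) = ratConst n c * ratVar j := fun j => by
    simp [ratConst, ratVar, ratScale_polyToRat, polyScale]
  ext i j
  simp [linPencil_apply, linForm_apply, hA, hc, hv, Finset.mul_sum, mul_assoc]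

end linPencil

/-! ### Symmetric realizations -/

section Realizes

variable {n k m : ℕ} {A : PencilCoeffs n k m} {f : RatMatrix n k}

theorem realizes_iff : Realizes A f ↔ IsSchur (linPencil A).toBlocks₁₁ (linPencil A).toBlocks₁₂
    (linPencil A).toBlocks₂₁ (linPencil A).toBlocks₂₂ f := by
  rw [Realizes, pencil_eq_linPencil]
  rfl

theorem Realizes.unique {g : RatMatrix n k} (hf : Realizes A f) (hg : Realizes A g) : f = g :=
  hf.2.trans hg.2.symm

theorem Realizes.smul (h : Realizes A f) {c : ℂ} (hc : c ≠ 0) :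
    Realizes (fun l => c • A l) (ratConst n c • f) := by
  rw [realizes_iff] at h ⊢
  rw [linPencil_smul]
  exact IsSchur.smul h ((map_ne_zero (ratConst n)).2 hc)

theorem Realizes.map {σ : ℂ →+* ℂ} {τ : RatFun n →+* RatFun n} (hστ : ExtendsConst σ τ)
    (h : Realizes A f) : Realizes (fun l => (A l).map σ) (f.map τ) := by
  rw [realizes_iff] at h ⊢
  rw [linPencil_map hστ]
  exact h.map τ

theorem Realizes.transpose (h : Realizes A f) : Realizes (fun l => (A l)ᵀ) fᵀ := by
  rw [realizes_iff] at h ⊢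
  rw [linPencil_transpose]
  exact IsSchur.transpose h

/-- Applying a symmetry to a realization realizes the transformed function. If the coefficients are
invariant, the two functions are the same Schur complement; if `A 0 = 0`, rescaling `z` by `c`
multiplies the pencil, hence its Schur complement, by `c`. -/
theorem Realizes.funHas (h : Realizes A f) {s : SymmetryKind} (hA : PencilHas A s) :
    FunHas f s := by
  cases s with
  | homogeneous =>
    intro c
    rw [realizes_iff] at h
    have h1 := IsSchur.map h (ratScale n c)
    have h2 := h.smul (r := ratConst n c) ((map_ne_zero (ratConst n)).2 c.ne_zero)
    let Q := (linPencil A).map (ratScale n c)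
    change IsSchur Q.toBlocks₁₁ Q.toBlocks₁₂ Q.toBlocks₂₁ Q.toBlocks₂₂ _ at h1
    have hQ : Q = ratConst n c • linPencil A := linPencil_map_ratScale hA c
    rw [hQ] at h1
    exact h1.2.trans h2.2.symm
  | real =>
    have h1 := h.map (extendsConst_ratConj n)
    rw [← (funext hA : A = _)] at h1
    exact h.unique h1
  | symmetric =>
    have h1 := h.transpose
    rw [← (funext hA : A = _)] at h1
    exact h.unique h1
  | hermitian =>
    have h1 := (h.map (extendsConst_ratConj n)).transpose
    rw [← (funext hA : A = fun l => ((A l).map (starRingEnd ℂ))ᵀ)] at h1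
    exact h.unique h1

theorem Realizes.exists_real (h : Realizes A f) (hf : FunHas f .real) :
    ∃ (m' : ℕ) (A' : PencilCoeffs n k m'), Realizes A' f ∧ PencilHas A' .real ∧
      (PencilHas A .homogeneous → PencilHas A' .homogeneous) := by
  have hI : ratConst n Complex.I * ratConst n Complex.I = -1 := by
    rw [← map_mul, Complex.I_mul_I, map_neg, map_one]
  have hre : matRe (ratConj n) f = f := by
    rw [matRe, ← (hf : f = f.map (ratConj n)), ← two_smul (RatFun n), smul_smul,
      inv_mul_cancel₀ two_ne_zero, one_smul]
  have h1 := IsSchur.realPart h.blockRealizes two_ne_zero (ratConj n) hI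
  simp only [hre, ← linPencil_matRe (extendsConst_ratConj n),
    ← linPencil_matIm (extendsConst_ratConj n), ← linPencil_neg, ← linPencil_fromCols,
    ← linPencil_fromRows, ← linPencil_fromBlocks] at h1
  obtain ⟨m', e, h2⟩ := BlockRealizes.exists_realizes h1
  have hconjRe : ∀ {α β : Type} (M : Matrix α β ℂ) i j,
      starRingEnd ℂ (matRe (starRingEnd ℂ) M i j) = matRe (starRingEnd ℂ) M i j := by
    intro α β M i j
    simp [matRe, add_comm, map_ofNat]
  have hconjIm : ∀ {α β : Type} (M : Matrix α β ℂ) i j,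
      starRingEnd ℂ (matIm (starRingEnd ℂ) Complex.I M i j) =
        matIm (starRingEnd ℂ) Complex.I M i j := by
    intro α β M i j
    simp [matIm, map_ofNat]
    ring
  refine ⟨m', _, h2, fun l => ?_, fun (h0 : A 0 = 0) => ?_⟩
  · ext i j
    simp only [submatrix_apply, map_apply]
    generalize e i = i'
    generalize e j = j'
    rcases i' with i | i | i <;> rcases j' with j | j | j <;>
    simp [hconjRe, hconjIm]
  · ext i j
    simp only [submatrix_apply, Matrix.zero_apply]
    generalize e i = i'
    generalize e j = j'
    rcases i' with i | i | i <;> rcases j' with j | j | j <;>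
    simp [h0, matRe, matIm, toBlocks₁₁, toBlocks₁₂, toBlocks₂₁, toBlocks₂₂]

/-- Treats (c) and (d) at once, with `σ` the identity or conjugation. The new blocks are `[b, (σ
c)ᵀ]`, `[(σ b)ᵀ; c]` and `[[0, (σ D)ᵀ], [D, 0]]` up to the factor `2⁻¹`, and `σ ∘ σ = id` makes the
whole matrix self-adjoint. -/
theorem Realizes.exists_selfAdjoint (h : Realizes A f) {σ : ℂ →+* ℂ}
    {τ : RatFun n →+* RatFun n} (hστ : ExtendsConst σ τ) (hσ : ∀ x, σ (σ x) = x)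
    (hσc : ∀ x, starRingEnd ℂ (σ x) = σ (starRingEnd ℂ x)) (hf : f = (f.map τ)ᵀ) :
    ∃ (m' : ℕ) (A' : PencilCoeffs n k m'), Realizes A' f ∧
      (∀ l, A' l = ((A' l).map σ)ᵀ) ∧
      (PencilHas A .homogeneous → PencilHas A' .homogeneous) ∧
      (PencilHas A .real → PencilHas A' .real) := by
  -- Halving `f` makes the sum of the realized function and its adjoint equal to `f` again.
  have h1 := (h.smul (inv_ne_zero (two_ne_zero (α := ℂ)))).blockRealizes
  have h2 := h1.antidiagonal (h1.map τ).transpose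
  have hτ : ((ratConst n 2⁻¹ • f).map τ)ᵀ = ratConst n 2⁻¹ • f := by
    conv_rhs => rw [hf]
    ext i j
    simp [map_inv₀, map_ofNat]
  have hsum : ratConst n 2⁻¹ • f + ratConst n 2⁻¹ • f = f := by
    rw [← add_smul, ← map_add, ← two_mul, mul_inv_cancel₀ two_ne_zero, map_one, one_smul]
  have hz : ∀ {ι : Type}, (0 : Matrix ι ι (RatFun n)) = linPencil fun _ => 0 :=
    linPencil_zero.symm
  simp only [hτ, hsum, hz, ← linPencil_map hστ, ← linPencil_transpose, ← linPencil_add,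
    ← linPencil_fromCols, ← linPencil_fromRows, ← linPencil_fromBlocks] at h2
  obtain ⟨m', e, h3⟩ := BlockRealizes.exists_realizes h2
  refine ⟨m', _, h3, fun l => ?_, fun (h0 : A 0 = 0) => ?_, fun hr l => ?_⟩
  · ext i j
    simp only [submatrix_apply, map_apply, transpose_apply]
    generalize e i = i'
    generalize e j = j'
    rcases i' with i | i | i <;> rcases j' with j | j | j <;>
    simp [hσ, add_comm, toBlocks₁₁, toBlocks₁₂, toBlocks₂₁, toBlocks₂₂]
  · ext i j
    simp only [submatrix_apply, Matrix.zero_apply]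
    generalize e i = i'
    generalize e j = j'
    rcases i' with i | i | i <;> rcases j' with j | j | j <;>
    simp [h0, toBlocks₁₁, toBlocks₁₂, toBlocks₂₁, toBlocks₂₂]
  · have hr' : ∀ i j, starRingEnd ℂ (A l i j) = A l i j := fun i j =>
      (congrFun (congrFun (hr l) i) j).symm
    ext i j
    simp only [submatrix_apply, map_apply]
    generalize e i = i'
    generalize e j = j'
    rcases i' with i | i | i <;> rcases j' with j | j | j <;>
    simp [hσc, hr', toBlocks₁₁, toBlocks₁₂, toBlocks₂₁, toBlocks₂₂, map_ofNat]

end Realizes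

/-! ### Combining the symmetries -/

theorem exists_realizes_of_funHas {n k : ℕ} {f : RatMatrix n k} (S : Set SymmetryKind)
    (hf : ∀ s ∈ S, FunHas f s) :
    ∃ (m : ℕ) (A : PencilCoeffs n k m), Realizes A f ∧ ∀ s ∈ S, PencilHas A s := by
  obtain ⟨m, A, hA, hh⟩ : ∃ (m : ℕ) (A : PencilCoeffs n k m), Realizes A f ∧
      (.homogeneous ∈ S → PencilHas A .homogeneous) := by
    by_cases hS : .homogeneous ∈ S
    · obtain ⟨m, A, h, h0⟩ := exists_realizes_of_homogeneous (hf _ hS)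
      exact ⟨m, A, h, fun _ => h0⟩
    · obtain ⟨m, A, h⟩ := exists_realizes f
      exact ⟨m, A, h, fun hh => absurd hh hS⟩
  -- Symmetric and Hermitian together force `f` to be real. A real realization is arranged in that
  -- case too, since real symmetric coefficients are Hermitian and one symmetrization then suffices.
  obtain ⟨m, A, hA, hh, hr⟩ : ∃ (m : ℕ) (A : PencilCoeffs n k m), Realizes A f ∧
      (.homogeneous ∈ S → PencilHas A .homogeneous) ∧
      (.real ∈ S ∨ .symmetric ∈ S ∧ .hermitian ∈ S → PencilHas A .real) := by
    by_cases hS : .real ∈ S ∨ .symmetric ∈ S ∧ .hermitian ∈ S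
    · have hreal : FunHas f .real := by
        rcases hS with hS | ⟨h1, h2⟩
        · exact hf _ hS
        · have e1 : f = fᵀ := hf _ h1
          have e2 : f = (f.map (ratConj n))ᵀ := hf _ h2
          exact e1.trans ((congrArg Matrix.transpose e2).trans (transpose_transpose _))
      obtain ⟨m', A', h', hr', hh'⟩ := hA.exists_real hreal
      exact ⟨m', A', h', fun hs => hh' (hh hs), fun _ => hr'⟩
    · exact ⟨m, A, hA, hh, fun h => absurd h hS⟩
  by_cases hsym : .symmetric ∈ S
  · obtain ⟨m', A', h', hs', hh', hr'⟩ := hA.exists_selfAdjoint (extendsConst_id n)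
      (fun _ => rfl) (fun _ => rfl) (hf _ hsym)
    refine ⟨m', A', h', fun s hs => ?_⟩
    cases s with
    | homogeneous => exact hh' (hh hs)
    | real => exact hr' (hr (.inl hs))
    | symmetric => exact hs'
    | hermitian =>
      intro l
      have e1 := hs' l
      have e2 := hr' (hr (.inr ⟨hsym, hs⟩)) l
      exact e1.trans (congrArg Matrix.transpose e2)
  by_cases hherm : .hermitian ∈ S
  · obtain ⟨m', A', h', hs', hh', hr'⟩ := hA.exists_selfAdjoint (extendsConst_ratConj n)
      Complex.conj_conj (fun _ => rfl) (hf _ hherm)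
    refine ⟨m', A', h', fun s hs => ?_⟩
    cases s with
    | homogeneous => exact hh' (hh hs)
    | real => exact hr' (hr (.inl hs))
    | symmetric => exact absurd hs hsym
    | hermitian => exact hs'
  · refine ⟨m, A, hA, fun s hs => ?_⟩
    cases s with
    | homogeneous => exact hh hs
    | real => exact hr (.inl hs)
    | symmetric => exact absurd hs hsym
    | hermitian => exact absurd hs hherm

theorem funHas_iff_exists_realizes {n k : ℕ} {f : RatMatrix n k} (S : Set SymmetryKind) :
    (∀ s ∈ S, FunHas f s) ↔
      ∃ (m : ℕ) (A : PencilCoeffs n k m), Realizes A f ∧ ∀ s ∈ S, PencilHas A s :=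
  ⟨exists_realizes_of_funHas S, fun ⟨_, _, h, hA⟩ s hs => h.funHas (hA s hs)⟩

theorem funHas_iff_exists_realizes_single {n k : ℕ} {f : RatMatrix n k} (s : SymmetryKind) :
    FunHas f s ↔ ∃ (m : ℕ) (A : PencilCoeffs n k m), Realizes A f ∧ PencilHas A s := by
  simpa using funHas_iff_exists_realizes (f := f) {s}

theorem theorem1 (n k : ℕ) (f : RatMatrix n k) :
    -- every `f` has a realization
    (∃ (m : ℕ) (A : PencilCoeffs n k m), Realizes A f) ∧
    -- (a) homogeneous of degree one
    ((∀ c : ℂˣ, f.map (ratScale n c) = ratConst n (c : ℂ) • f) ↔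
      ∃ (m : ℕ) (A : PencilCoeffs n k m), Realizes A f ∧ A 0 = 0) ∧
    -- (b) real
    (f = f.map (ratConj n) ↔
      ∃ (m : ℕ) (A : PencilCoeffs n k m), Realizes A f ∧
        ∀ j, A j = (A j).map (starRingEnd ℂ)) ∧
    -- (c) symmetric
    (f = f.transpose ↔
      ∃ (m : ℕ) (A : PencilCoeffs n k m), Realizes A f ∧ ∀ j, A j = (A j).transpose) ∧
    -- (d) Hermitian
    (f = (f.map (ratConj n)).transpose ↔
      ∃ (m : ℕ) (A : PencilCoeffs n k m), Realizes A f ∧ ∀ j, A j = (A j).conjTranspose) ∧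
    -- (e) any combination of (a)-(d)
    (∀ S : Set SymmetryKind,
      (∀ s ∈ S, FunHas f s) ↔
        ∃ (m : ℕ) (A : PencilCoeffs n k m), Realizes A f ∧ ∀ s ∈ S, PencilHas A s) :=
  ⟨exists_realizes f, funHas_iff_exists_realizes_single .homogeneous,
    funHas_iff_exists_realizes_single .real, funHas_iff_exists_realizes_single .symmetric,
    funHas_iff_exists_realizes_single .hermitian, funHas_iff_exists_realizes⟩
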